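/- Let $G=(V,E)$ be a finite, simple, connected graph. For $x\in\mathbb{R}^V$ write $\mathrm{supp}(x)=\{v: x_v\neq 0\}$, $\mathrm{supp}_+(x)=\{v: x_v>0\}$, $\mathrm{supp}_-(x)=\{v:x_v<0\}$, and for $S\subseteq V$ let $G[S]$ be the induced subgraph and $N(S)$ the set of vertices outside $S$ adjacent to a vertex of $S$. A nonzero vector $x$ is *broken* if $G[\mathrm{supp}_+(x)]$ is disconnected. A linear subspace $L\subseteq\mathbb{R}^V$ is a *semivalid representation* of $G$ if for every nonzero $x\in L$: (i) $\mathrm{supp}_+(x)$ and $\mathrm{supp}_-(x)$ are nonempty; (ii) $G[\mathrm{supp}_+(x)]$ is connected, or it has exactly two connected components and $G[\mathrm{supp}_-(x)]$ is connected; (iii) if $\mathrm{supp}(x)$ is inclusion-minimal among supports of nonzero vectors of $L$, then $G[\mathrm{supp}_+(x)]$ and $G[\mathrm{supp}_-(x)]$ are nonempty and connected; (iv) if $G[\mathrm{supp}_+(x)]$ is disconnected, then there is no edge between $\mathrm{supp}_+(x)$ and $\mathrm{supp}_-(x)$, and $N(C)=N(\mathrm{supp}(x))$ for every connected component $C$ of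 $G[\mathrm{supp}(x)]$. Let $\mathcal{P}(L)$ be the complete fan in $L$ whose relatively open cones are the classes of vectors of $L$ with the same $\mathrm{supp}_+$ and the same $\mathrm{supp}_-$. A cone of $\mathcal{P}(L)$ is *broken* if it consists of broken vectors. Faces of polytopes are taken relatively open, and a relatively open polyhedron $\eta$ is called a face of $\tau$ if $\overline{\eta}$ is a face of $\overline{\tau}$. A polytope $\mathbf{P}\subset L$ with the origin in its interior relative to $L$ is a *polytopal representation* of $G$ (arising from $L$) if: (i) its vertex set is centrally symmetric; (ii) the fan of cones over the proper faces of $\mathbf{P}$ subdivides $\mathcal{P}(L)$, so each nonempty proper face $\mathbf{F}$ lies in a unique cone $\gamma(\mathbf{F})\in\mathcal{P}(L)$; (iii) all proper faces of $\mathbf{P}$ are simplices; (iv) whenever nonempty faces $\mathbf{E},\mathbf{F}$ of $\partial\mathbf{P}$ are faces of a common face of $\partial\mathbf{P}$, one of $\gamma(\mathbf{E}),\gamma(\mathbf{F})$ is a face of the other (possibly equal to it); (v) for every vertex $\mathbf{a}$ of $\mathbf{P}$, all edges of $\mathbf{P}$ that belong to the closed star of $\mathbf{a}$ in $\partial\mathbf{P}$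 and lie in a broken cone lie in the same broken cone. Two faces $\mathbf{F},\mathbf{F}'$ of $\mathbf{P}$ are *antipodal* if there are two distinct parallel hyperplanes $h,h'$ of $L$ with $\mathbf{F}\subset h$, $\mathbf{F}'\subset h'$ and $\mathbf{P}$ between $h$ and $h'$. For a polytope $\mathbf{Q}$, $\mathbf{Q}^{(1)}$ denotes its $1$-skeleton, i.e. the union of its faces of dimension at most $1$. Regard $G$ as a one-dimensional complex; a continuous map $\mathbf{P}^{(1)}\to G$ is *cellular* if it maps every vertex of $\mathbf{P}$ to a node of $G$. **Proposition.** Let $G$ be a connected graph, $L$ a semivalid representation of $G$, and $\mathbf{P}$ a polytopal representation of $G$ arising from $L$. Then there is a cellular map $f\colon\mathbf{P}^{(1)}\to G$ such that for every pair of antipodal faces $\mathbf{F},\mathbf{F}'$ of $\mathbf{P}$, the smallest subgraphs of $G$ containing $f(\mathbf{F}^{(1)})$ and $f(\mathbf{F}'^{(1)})$, respectively, have no common nodes. -/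

import Mathlib

noncomputable section

namespace GraphRep

/-! Vectors and graphs -/

section Graph

variable {V : Type*}

/-- The set of coordinates where `x` is positive. -/
def posSupp (x : V → ℝ) : Set V := {v | 0 < x v}

/-- The set of coordinates where `x` is negative. -/
def negSupp (x : V → ℝ) : Set V := {v | x v < 0}

/-- The set of coordinates where `x` is nonzero. -/
def supp (x : V → ℝ) : Set V := {v | x v ≠ 0}

/-- `N(S)`: the vertices outside `S` that are adjacent to a vertex of `S`. -/
def nbhd (G : SimpleGraph V) (S : Set V) : Set V := {w | w ∉ S ∧ ∃ v ∈ S, G.Adj v w}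

/-- A nonzero vector is broken if its positive support induces a disconnected subgraph. -/
def IsBroken (G : SimpleGraph V) (x : V → ℝ) : Prop :=
  x ≠ 0 ∧ ¬ (G.induce (posSupp x)).Preconnected

/-- Semivalid representations of `G`. -/
structure IsSemivalid (G : SimpleGraph V) (L : Submodule ℝ (V → ℝ)) : Prop where
  supp_nonempty : ∀ x ∈ L, x ≠ 0 → (posSupp x).Nonempty ∧ (negSupp x).Nonempty
  components : ∀ x ∈ L, x ≠ 0 →
    (G.induce (posSupp x)).Connected ∨
      (Nat.card (G.induce (posSupp x)).ConnectedComponent = 2 ∧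
        (G.induce (negSupp x)).Connected)
  minimal_support : ∀ x ∈ L, x ≠ 0 →
    (∀ y ∈ L, y ≠ 0 → supp y ⊆ supp x → supp y = supp x) →
    (G.induce (posSupp x)).Connected ∧ (G.induce (negSupp x)).Connected
  broken : ∀ x ∈ L, x ≠ 0 → ¬ (G.induce (posSupp x)).Preconnected →
    (∀ u ∈ posSupp x, ∀ v ∈ negSupp x, ¬ G.Adj u v) ∧
      ∀ C : (G.induce (supp x)).ConnectedComponent,
        nbhd G (Subtype.val '' C.supp) = nbhd G (supp x)

/-- The sign fan of `L`: its (relatively open) cones are the classes of vectors of `L` with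
the same positive and the same negative support. -/
def signFan (L : Submodule ℝ (V → ℝ)) : Set (Set L) :=
  {α | ∃ x : L, α = {y : L | posSupp (y : V → ℝ) = posSupp (x : V → ℝ) ∧
    negSupp (y : V → ℝ) = negSupp (x : V → ℝ)}}

/-- A broken cone: a cone of the sign fan that consists of broken vectors. -/
def IsBrokenCone (G : SimpleGraph V) (L : Submodule ℝ (V → ℝ)) (β : Set L) : Prop :=
  β ∈ signFan L ∧ ∀ x ∈ β, IsBroken G (x : V → ℝ)

/-- The point of `ℝ^V` that realizes the node `v` of a graph on `V`: the basis vector `e_v`. -/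
def nodePoint (v : V) : V → ℝ :=
  open Classical in Pi.single v 1

/-- The body, in `ℝ^V`, of a subgraph `H` regarded as a one-dimensional simplicial complex:
the nodes are the basis vectors `e_v`, and an arc `uv` is the segment from `e_u` to `e_v`. -/
def body {G : SimpleGraph V} (H : G.Subgraph) : Set (V → ℝ) :=
  {p | (∃ v ∈ H.verts, p = nodePoint v) ∨
    ∃ u v, H.Adj u v ∧ p ∈ segment ℝ (nodePoint u) (nodePoint v)}

/-- `H` is the smallest subgraph of `G` whose body contains `A`. -/
def IsSmallestSubgraph (G : SimpleGraph V) (A : Set (V → ℝ)) (H : G.Subgraph) : Prop :=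
  IsLeast {K : G.Subgraph | A ⊆ body K} H

end Graph

/-! Polytopes. A face is represented by the corresponding closed face; the relatively open face
is its intrinsic interior. -/

section Polytope

variable {E : Type*} [NormedAddCommGroup E] [NormedSpace ℝ E]

/-- A polytope: a bounded intersection of finitely many closed half-spaces. -/
def IsPolytope (P : Set E) : Prop :=
  Bornology.IsBounded P ∧
    ∃ (ι : Type) (_ : Finite ι) (l : ι → E →L[ℝ] ℝ) (c : ι → ℝ), P = {x | ∀ i, l i x ≤ c i}

/-- The (closed) faces of `P`: the intersections of `P` with supporting hyperplanes, together
with the empty set and `P` itself. -/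
def IsFace (P F : Set E) : Prop := IsExposed ℝ P F

/-- The nonempty faces of the boundary complex of `P`. -/
def IsBoundaryFace (P F : Set E) : Prop := IsFace P F ∧ F.Nonempty ∧ F ≠ P

/-- The dimension of (the affine hull of) a nonempty set. -/
def dim (F : Set E) : ℕ := Module.finrank ℝ (vectorSpan ℝ F)

/-- The body of the `k`-skeleton of `P`: the union of all faces of dimension at most `k`. -/
def skeleton (P : Set E) (k : ℕ) : Set E := {x | ∃ F, IsFace P F ∧ dim F ≤ k ∧ x ∈ F}

/-- The vertices of `P`. -/
def vertices (P : Set E) : Set E := {v | IsFace P {v}}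

/-- The edges of `P`. -/
def IsEdge (P e : Set E) : Prop := IsFace P e ∧ e.Nonempty ∧ dim e = 1

/-- A (closed) simplex. -/
def IsSimplex (F : Set E) : Prop :=
  ∃ t : Finset E, t.Nonempty ∧ AffineIndependent ℝ (Subtype.val : t → E) ∧
    F = convexHull ℝ (t : Set E)

/-- The union of all open rays from the origin through points of `A`. -/
def coneOver (A : Set E) : Set E := {y | ∃ r : ℝ, 0 < r ∧ ∃ x ∈ A, y = r • x}

/-- The fan of a polytope `P` with the origin in its interior: the cones over the relatively
open proper faces, and the origin (the cone over the empty face). -/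
def faceFan (P : Set E) : Set (Set E) :=
  {α | α = {0} ∨ ∃ F, IsBoundaryFace P F ∧ α = coneOver (intrinsicInterior ℝ F)}

/-- The family `D` of polyhedra subdivides the family `C`. -/
def Subdivides (D C : Set (Set E)) : Prop :=
  ⋃₀ D = ⋃₀ C ∧ ∀ η ∈ D, ∃ τ ∈ C, η ⊆ τ

/-- The (relatively open) polyhedron `α` is a face of the (relatively open) polyhedron `β`. -/
def IsOpenFace (β α : Set E) : Prop := IsFace (closure β) (closure α)

/-- `e` is a face in the closed star of `a` in the boundary complex of `P`. -/
def InStar (P : Set E) (a : E) (e : Set E) : Prop :=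
  ∃ D, IsBoundaryFace P D ∧ a ∈ D ∧ IsFace D e

/-- Faces `F`, `F'` of a full-dimensional `P` are antipodal: they lie in two distinct parallel
hyperplanes `l = c` and `l = c'` such that `P` is between the two. -/
def Antipodal (P F F' : Set E) : Prop :=
  ∃ (l : E →L[ℝ] ℝ) (c c' : ℝ), l ≠ 0 ∧ c < c' ∧ (∀ x ∈ F, l x = c) ∧ (∀ x ∈ F', l x = c') ∧
    ∀ x ∈ P, c ≤ l x ∧ l x ≤ c'

end Polytope

section Representation

variable {V : Type*} [Fintype V]

/-- `e` is a broken edge of `P` that lies in the broken cone `β`. -/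
def IsBrokenEdgeIn (G : SimpleGraph V) (L : Submodule ℝ (V → ℝ)) (P e β : Set L) : Prop :=
  IsEdge P e ∧ IsBrokenCone G L β ∧ intrinsicInterior ℝ e ⊆ β

/-- `P` is a polytopal representation of `G` arising from the sign fan of `L`. -/
structure IsPolytopalRepresentation (G : SimpleGraph V) (L : Submodule ℝ (V → ℝ))
    (P : Set L) : Prop where
  polytope : IsPolytope P
  zero_mem_interior : (0 : L) ∈ interior P
  symmetric : ∀ v ∈ vertices P, -v ∈ vertices P
  subdivides : Subdivides (faceFan P) (signFan L)
  simplicial : ∀ F, IsBoundaryFace P F → IsSimplex F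
  inclusions : ∀ D E F : Set L, IsBoundaryFace P D → IsBoundaryFace P E → IsBoundaryFace P F →
    IsFace D E → IsFace D F →
    ∀ α ∈ signFan L, ∀ β ∈ signFan L, intrinsicInterior ℝ E ⊆ α → intrinsicInterior ℝ F ⊆ β →
      IsOpenFace β α ∨ IsOpenFace α β
  broken_edges : ∀ a ∈ vertices P, ∀ e₁ e₂ β₁ β₂ : Set L,
    InStar P a e₁ → InStar P a e₂ → IsBrokenEdgeIn G L P e₁ β₁ → IsBrokenEdgeIn G L P e₂ β₂ →
      β₁ = β₂

/-- `f` restricts to a cellular map from the `1`-skeleton of `P` to (the body of) `G`. -/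
structure IsCellularMap (G : SimpleGraph V) {L : Submodule ℝ (V → ℝ)} (P : Set L)
    (f : L → V → ℝ) : Prop where
  continuousOn : ContinuousOn f (skeleton P 1)
  mapsTo_body : Set.MapsTo f (skeleton P 1) (body (⊤ : G.Subgraph))
  mapsTo_nodes : Set.MapsTo f (skeleton P 0) (Set.range nodePoint)

end Representation

end GraphRep

end

/-! Each vertex or edge `e` of `P` receives a carrier: a set `T` of nodes inducing a connected
subgraph in which `f` maps `e`. By central symmetry, antipodal faces lie in opposite boundary faces
`D` and `-D` (`exists_opposite`), so it suffices that carriers of cells in `D` and in `-D` are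
disjoint.

Vertices of a common boundary face have comparable sign vectors, so an open edge `ab` has the signs
of `a + b`. If `ab` lies in `D` and `a'b'` in `-D`, then `a + b` and `-(a' + b')` are comparable,
and the positive supports of `a + b` and `a' + b'` are disjoint. These supports would be the
carriers if they were all connected.

The carrier of a broken edge is its positive support together with the neighborhood of its support.
This is connected because every node of the neighborhood is adjacent to every component of the
support. In return, carriers opposite to a broken edge must stay inside its negative support, which
is connected. Condition (v) makes this negative support the same for all broken edges around `-a`,
so the node of `a` can be chosen in it (`exists_node_choice`). An edge opposite to a broken one is
not broken (`not_broken_of_opposite`), and its positive support is nested with that negative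
support, so their intersection is connected (`exists_cellSet`). `CellSet.disjoint` combines the
cases. -/

namespace GraphRep

/-! ### Faces of polytopes -/

section Polytope

variable {E : Type*} [NormedAddCommGroup E] [NormedSpace ℝ E]

lemma IsPolytope.convex {P : Set E} (hP : IsPolytope P) : Convex ℝ P := by
  obtain ⟨-, ι, _, l, c, rfl⟩ := hP
  rw [Set.ofPred_forall]
  exact convex_iInter fun i => convex_halfSpace_le (l i).toLinearMap.isLinear (c i)

lemma IsPolytope.isClosed {P : Set E} (hP : IsPolytope P) : IsClosed P := by
  obtain ⟨-, ι, _, l, c, rfl⟩ := hP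
  rw [Set.ofPred_forall]
  exact isClosed_iInter fun i => isClosed_le (l i).continuous continuous_const

lemma IsPolytope.isCompact [FiniteDimensional ℝ E] {P : Set E} (hP : IsPolytope P) :
    IsCompact P :=
  have := FiniteDimensional.proper_real E
  Metric.isCompact_of_isClosed_isBounded hP.isClosed hP.1

/-- An extreme convex subset of a polyhedron contains all points of the polyhedron at which all
the constraints tight on the subset are tight. -/
lemma mem_of_isExtreme_of_tight {ι : Type*} [Finite ι] {l : ι → E →L[ℝ] ℝ} {c : ι → ℝ}
    {F : Set E} (hF : IsExtreme ℝ {x | ∀ i, l i x ≤ c i} F) (hc : Convex ℝ F) (hne : F.Nonempty)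
    {y : E} (hy : ∀ i, l i y ≤ c i) (ht : ∀ i, (∀ x ∈ F, l i x = c i) → l i y = c i) : y ∈ F := by
  classical
  have := Fintype.ofFinite ι
  -- Averaging points of `F`, one constraint at a time, gives a point of `F` where only the
  -- constraints tight on all of `F` are tight.
  have key : ∀ s : Finset ι, ∃ x ∈ F, ∀ i ∈ s, (∃ z ∈ F, l i z < c i) → l i x < c i := by
    intro s
    induction s using Finset.induction with
    | empty => obtain ⟨x, hx⟩ := hne; exact ⟨x, hx, by simp⟩
    | insert j s hj ih =>
      obtain ⟨x, hx, hxs⟩ := ih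
      by_cases hz : ∃ z ∈ F, l j z < c j
      · obtain ⟨z, hz, hlz⟩ := hz
        refine ⟨(1 / 2 : ℝ) • x + (1 / 2 : ℝ) • z,
          hc hx hz (by norm_num) (by norm_num) (by norm_num), fun i hi h => ?_⟩
        have hxi := hF.subset hx i
        have hzi := hF.subset hz i
        simp only [map_add, map_smul, smul_eq_mul]
        rcases Finset.mem_insert.1 hi with rfl | hi
        · linarith
        · linarith [hxs i hi h]
      · refine ⟨x, hx, fun i hi h => ?_⟩
        rcases Finset.mem_insert.1 hi with rfl | hi
        · exact absurd h hz
        · exact hxs i hi h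
  obtain ⟨x, hx, hxs⟩ := key Finset.univ
  -- From `x` one can move slightly away from `y`: slack constraints survive by continuity, and the
  -- others are tight at both `x` and `y`. Then `x` is interior to a segment of the polyhedron with
  -- endpoint `y`.
  have hev : ∀ᶠ ε : ℝ in nhdsWithin 0 (Set.Ioi 0), ∀ i, l i (x + ε • (x - y)) ≤ c i := by
    rw [Filter.eventually_all]
    intro i
    by_cases hi : ∃ z ∈ F, l i z < c i
    · have hlt := hxs i (Finset.mem_univ i) hi
      have hcont : Continuous fun ε : ℝ => l i (x + ε • (x - y)) := by fun_prop
      have : ∀ᶠ ε : ℝ in nhds 0, l i (x + ε • (x - y)) < c i :=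
        hcont.continuousAt.eventually_lt continuousAt_const (by simpa using hlt)
      exact (this.filter_mono nhdsWithin_le_nhds).mono fun _ h => h.le
    · push Not at hi
      have htight : ∀ z ∈ F, l i z = c i := fun z hz => (hF.subset hz i).antisymm (hi z hz)
      refine Filter.Eventually.of_forall fun ε => ?_
      simp [htight x hx, ht i htight]
  obtain ⟨ε, hε, hpos⟩ := (hev.and self_mem_nhdsWithin).exists
  have hpos : 0 < ε := hpos
  refine hF.left_mem_of_mem_openSegment hy hε hx
    ⟨ε / (1 + ε), 1 / (1 + ε), by positivity, by positivity, by field_simp; ring, ?_⟩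
  have h1 : (1 + ε) ≠ 0 := by positivity
  have h2 : (1 / (1 + ε)) • ((1 + ε) • x) = x := by
    rw [smul_smul, one_div_mul_cancel h1, one_smul]
  nth_rewrite 3 [← h2]
  module

/-- The sum of the constraints tight on `F` is a functional that exposes `F`; this uses that the
constraints are finite in number. -/
lemma IsPolytope.isFace_of_isExtreme {P F : Set E} (hP : IsPolytope P) (hF : IsExtreme ℝ P F)
    (hc : Convex ℝ F) : IsFace P F := by
  classical
  obtain ⟨-, ι, _, l, c, rfl⟩ := hP
  have := Fintype.ofFinite ι
  intro hne
  let I : Finset ι := Finset.univ.filter fun i => ∀ x ∈ F, l i x = c i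
  have hI : ∀ x ∈ F, ∑ i ∈ I, l i x = ∑ i ∈ I, c i := fun x hx =>
    Finset.sum_congr rfl fun i hi => (Finset.mem_filter.1 hi).2 x hx
  refine ⟨∑ i ∈ I, l i, Set.Subset.antisymm (fun x hx => ⟨hF.subset hx, fun y hy => ?_⟩) ?_⟩
  · simp only [sum_apply, hI x hx]
    exact Finset.sum_le_sum fun i _ => hy i
  · rintro y ⟨hy, hmax⟩
    refine mem_of_isExtreme_of_tight hF hc hne hy fun i hi => ?_
    obtain ⟨x, hx⟩ := hne
    have h1 := hmax x (hF.subset hx)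
    simp only [sum_apply, hI x hx] at h1
    have h2 := (Finset.sum_eq_sum_iff_of_le fun i _ => hy i).1
      ((Finset.sum_le_sum fun i _ => hy i).antisymm h1)
    exact h2 i (Finset.mem_filter.2 ⟨Finset.mem_univ i, hi⟩)

/-- Exposedness is not transitive for general convex sets, but extremality is, and for polytopes the
two agree. -/
lemma IsPolytope.isFace_trans {P F F' : Set E} (hP : IsPolytope P) (hF : IsFace P F)
    (hF' : IsFace F F') : IsFace P F' :=
  hP.isFace_of_isExtreme ((IsExposed.isExtreme hF).trans (IsExposed.isExtreme hF'))
    (IsExposed.convex hF' (IsExposed.convex hF hP.convex))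

lemma IsPolytope.finite_faces {P : Set E} (hP : IsPolytope P) : {F | IsFace P F}.Finite := by
  have hconv := hP.convex
  obtain ⟨-, ι, _, l, c, rfl⟩ := hP
  -- A face is determined by its tight constraints. The second entry singles out the empty face, on
  -- which every constraint is vacuously tight.
  let g : Set E → Set ι × Prop := fun F => ({i | ∀ x ∈ F, l i x = c i}, F.Nonempty)
  have aux : ∀ F F', IsFace {x | ∀ i, l i x ≤ c i} F → IsFace {x | ∀ i, l i x ≤ c i} F' →
      g F = g F' → F ⊆ F' := by
    intro F F' hF hF' h x hx
    have hne : F'.Nonempty := (congrArg Prod.snd h).mp ⟨x, hx⟩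
    refine mem_of_isExtreme_of_tight (IsExposed.isExtreme hF') (IsExposed.convex hF' hconv) hne
      (hF.subset hx) fun i hi => ?_
    have h1 : i ∈ {i | ∀ x ∈ F, l i x = c i} := by
      rw [show {i | ∀ x ∈ F, l i x = c i} = {i | ∀ x ∈ F', l i x = c i} from congrArg Prod.fst h]
      exact hi
    exact h1 x hx
  refine Set.Finite.of_injOn (f := g) (t := Set.univ) (fun _ _ => trivial) ?_ Set.finite_univ
  intro F hF F' hF' h
  exact (aux F F' hF hF' h).antisymm (aux F' F hF' hF h.symm)

lemma IsPolytope.neg_mem [FiniteDimensional ℝ E] {P : Set E} (hP : IsPolytope P)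
    (hsymm : ∀ v ∈ vertices P, -v ∈ vertices P) {x : E} (hx : x ∈ P) : -x ∈ P := by
  have hsub : P ⊆ -P := by
    have hcl : IsClosed (-P) := hP.isClosed.neg
    rw [← closure_convexHull_extremePoints hP.isCompact hP.convex] at hx
    conv_lhs => rw [← closure_convexHull_extremePoints hP.isCompact hP.convex]
    refine closure_minimal (convexHull_min (fun v hv => ?_) hP.convex.neg) hcl
    have hv' : v ∈ vertices P :=
      hP.isFace_of_isExtreme (isExtreme_singleton.2 hv) (convex_singleton v)
    exact IsExposed.subset (hsymm v hv') rfl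
  exact hsub hx

lemma IsFace.neg {P F : Set E} (hneg : ∀ x ∈ P, -x ∈ P) (hF : IsFace P F) : IsFace P (-F) := by
  intro hne
  obtain ⟨l, rfl⟩ := hF (Set.nonempty_neg.1 hne)
  refine ⟨-l, Set.Subset.antisymm ?_ ?_⟩
  · rintro x ⟨hx, hmax⟩
    refine ⟨by simpa using hneg _ hx, fun y hy => ?_⟩
    have := hmax (-y) (hneg y hy)
    simpa using this
  · rintro x ⟨hx, hmax⟩
    refine ⟨hneg x hx, fun y hy => ?_⟩
    have := hmax (-y) (hneg y hy)
    simpa using this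

/-- A compact convex set of dimension one is a segment, and its endpoints are faces of it. -/
lemma exists_eq_segment_of_dim_eq_one {F : Set E} (hF : IsCompact F) (hc : Convex ℝ F)
    (hne : F.Nonempty) (hdim : dim F = 1) :
    ∃ a b, a ≠ b ∧ F = segment ℝ a b ∧ IsFace F {a} ∧ IsFace F {b} := by
  obtain ⟨⟨u, hu⟩, hu0, hspan⟩ := finrank_eq_one_iff'.1 hdim
  have hu0' : u ≠ 0 := fun h => hu0 (Subtype.ext h)
  obtain ⟨l, hl⟩ := SeparatingDual.exists_eq_one (R := ℝ) hu0'
  have hsub : ∀ x ∈ F, ∀ y ∈ F, y - x = (l y - l x) • u := by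
    intro x hx y hy
    obtain ⟨r, hr⟩ := hspan ⟨y - x, vsub_mem_vectorSpan ℝ hy hx⟩
    have hr : r • u = y - x := congrArg Subtype.val hr
    have : r = l y - l x := by rw [← map_sub, ← hr]; simp [hl]
    rw [← this, hr]
  have hinj : ∀ x ∈ F, ∀ y ∈ F, l x = l y → x = y := by
    intro x hx y hy h
    have := hsub x hx y hy
    rw [h, sub_self, zero_smul, sub_eq_zero] at this
    exact this.symm
  obtain ⟨a, ha, hmin⟩ := hF.exists_isMinOn hne l.continuous.continuousOn
  obtain ⟨b, hb, hmax⟩ := hF.exists_isMaxOn hne l.continuous.continuousOn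
  have hmin : ∀ x ∈ F, l a ≤ l x := fun x hx => hmin hx
  have hmax : ∀ x ∈ F, l x ≤ l b := fun x hx => hmax hx
  have hab : a ≠ b := by
    rintro rfl
    have hs : F.Subsingleton := fun x hx y hy => hinj x hx y hy
      (((hmax x hx).antisymm (hmin x hx)).trans ((hmax y hy).antisymm (hmin y hy)).symm)
    have : vectorSpan ℝ F = ⊥ := vectorSpan_of_subsingleton ℝ hs
    rw [dim, this, finrank_bot] at hdim
    exact absurd hdim (by norm_num)
  have hlt : l a < l b := (hmin b hb).lt_of_ne fun h => hab (hinj a ha b hb h)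
  refine ⟨a, b, hab, Set.Subset.antisymm (fun x hx => ?_) (hc.segment_subset ha hb), ?_, ?_⟩
  · rw [segment_eq_image']
    have hpos : 0 < l b - l a := sub_pos.2 hlt
    refine ⟨(l x - l a) / (l b - l a), ⟨div_nonneg (sub_nonneg.2 (hmin x hx)) hpos.le,
      (div_le_one hpos).2 (sub_le_sub_right (hmax x hx) _)⟩, ?_⟩
    simp only
    rw [hsub a ha b hb, smul_smul, div_mul_cancel₀ _ hpos.ne', ← hsub a ha x hx, add_sub_cancel]
  · refine fun _ => ⟨-l, Set.Subset.antisymm ?_ ?_⟩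
    · rintro _ rfl
      exact ⟨ha, fun y hy => neg_le_neg (hmin y hy)⟩
    · rintro x ⟨hx, h⟩
      exact hinj x hx a ha ((neg_le_neg_iff.1 (h a ha)).antisymm (hmin x hx))
  · refine fun _ => ⟨l, Set.Subset.antisymm ?_ ?_⟩
    · rintro _ rfl
      exact ⟨hb, fun y hy => hmax y hy⟩
    · rintro x ⟨hx, h⟩
      exact hinj x hx b hb ((hmax x hx).antisymm (h b hb))

lemma IsPolytope.exists_edge_eq_segment [FiniteDimensional ℝ E] {P e : Set E} (hP : IsPolytope P)
    (he : IsEdge P e) :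
    ∃ a ∈ vertices P, ∃ b ∈ vertices P, a ≠ b ∧ e = segment ℝ a b := by
  obtain ⟨hf, hne, hdim⟩ := he
  obtain ⟨a, b, hab, rfl, ha, hb⟩ := exists_eq_segment_of_dim_eq_one
    (IsExposed.isCompact hf hP.isCompact) (IsExposed.convex hf hP.convex) hne hdim
  exact ⟨a, hP.isFace_trans hf ha, b, hP.isFace_trans hf hb, hab, rfl⟩

lemma exists_eq_singleton_of_dim_eq_zero [FiniteDimensional ℝ E] {F : Set E} (hne : F.Nonempty)
    (hdim : dim F = 0) : ∃ a, F = {a} := by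
  rw [dim, Submodule.finrank_eq_zero, vectorSpan_eq_bot_iff_subsingleton] at hdim
  exact Set.exists_eq_singleton_iff_nonempty_subsingleton.2 ⟨hne, hdim⟩

lemma left_notMem_intrinsicInterior_segment {a b : E} (hab : a ≠ b) :
    a ∉ intrinsicInterior ℝ (segment ℝ a b) := by
  rw [mem_intrinsicInterior]
  rintro ⟨y, hy, hya⟩
  have hmem : ∀ t : ℝ, AffineMap.lineMap a b t ∈ affineSpan ℝ (segment ℝ a b) := fun t =>
    AffineMap.lineMap_mem t (subset_affineSpan ℝ _ (left_mem_segment ℝ a b))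
      (subset_affineSpan ℝ _ (right_mem_segment ℝ a b))
  let g : ℝ → affineSpan ℝ (segment ℝ a b) := fun t => ⟨AffineMap.lineMap a b t, hmem t⟩
  have hg : Continuous g := AffineMap.lineMap_continuous.subtype_mk hmem
  have hg0 : g 0 = y := Subtype.ext (by simp [g, hya])
  have hev : ∀ᶠ t in nhds (0 : ℝ), AffineMap.lineMap a b t ∈ segment ℝ a b := by
    have : ∀ᶠ t in nhds (0 : ℝ), g t ∈ ((↑) ⁻¹' segment ℝ a b : Set (affineSpan ℝ _)) :=
      hg.continuousAt.eventually_mem (by rw [hg0]; exact mem_interior_iff_mem_nhds.1 hy)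
    exact this
  obtain ⟨t, ht, hneg⟩ :=
    ((hev.filter_mono nhdsWithin_le_nhds).and (self_mem_nhdsWithin (s := Set.Iio (0 : ℝ)))).exists
  rw [segment_eq_image_lineMap] at ht
  obtain ⟨s, hs, hst⟩ := ht
  have : s = t := AffineMap.lineMap_injective ℝ hab hst
  exact absurd hs.1 (not_le.2 (this ▸ hneg))

lemma intrinsicInterior_segment_subset (a b : E) :
    intrinsicInterior ℝ (segment ℝ a b) ⊆ openSegment ℝ a b := by
  intro x hx
  rcases eq_or_ne a b with rfl | hab
  · simpa using hx
  have hxs := intrinsicInterior_subset hx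
  rw [← insert_endpoints_openSegment] at hxs
  rcases hxs with rfl | rfl | h
  · exact absurd hx (left_notMem_intrinsicInterior_segment hab)
  · rw [segment_symm] at hx
    exact absurd hx (left_notMem_intrinsicInterior_segment hab.symm)
  · exact h

/-- Two edges that share a point other than an endpoint agree. -/
lemma edge_subset_of_mem {P : Set E} {a b : E} {e : Set E} (hP : IsPolytope P)
    (hf : IsFace P (segment ℝ a b)) (hf' : IsFace P e) {x : E}
    (hx : x ∈ openSegment ℝ a b) (hx' : x ∈ e) : segment ℝ a b ⊆ e := by
  have ha := hf.subset (left_mem_segment ℝ a b)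
  have hb := hf.subset (right_mem_segment ℝ a b)
  have hext := IsExposed.isExtreme hf'
  exact (IsExposed.convex hf' hP.convex).segment_subset
    (hext.left_mem_of_mem_openSegment ha hb hx' hx)
    (hext.right_mem_of_mem_openSegment ha hb hx' hx)

end Polytope

end GraphRep

/-! ### Extending a vertex map over the 1-skeleton -/

namespace GraphRep

/-- A path between the images of the endpoints, transported to a metric space. -/
lemma exists_continuous_of_joinedIn {X Y : Type*} [MetricSpace X] [TopologicalSpace Y] {B : Set Y} {y z : Y}
    (h : JoinedIn B y z) {a b : X} (hab : a ≠ b) :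
    ∃ g : X → Y, Continuous g ∧ g a = y ∧ g b = z ∧ ∀ x, g x ∈ B := by
  refine ⟨fun x => h.somePath.extend (dist a x / dist a b), ?_, by simp, ?_, fun x => ?_⟩
  · exact h.somePath.continuous_extend.comp (by fun_prop)
  · simp [div_self (dist_ne_zero.2 hab)]
  · exact h.somePath_mem _

section Polytope

variable {E : Type*} [NormedAddCommGroup E] [NormedSpace ℝ E]

lemma eq_left_or_eq_right_of_mem_vertices {P : Set E} {a b v : E} (hs : segment ℝ a b ⊆ P)
    (hv : v ∈ vertices P) (hm : v ∈ segment ℝ a b) : v = a ∨ v = b := by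
  have h : v ∈ P.extremePoints ℝ := isExtreme_singleton.1 (IsExposed.isExtreme hv)
  rcases (mem_extremePoints_iff_forall_segment.1 h).2 a (hs (left_mem_segment ℝ a b)) b
    (hs (right_mem_segment ℝ a b)) hm with h | h
  · exact Or.inl h.symm
  · exact Or.inr h.symm

/-- A map defined on the vertices extends to the `1`-skeleton of a polytope as soon as the images
of the endpoints of each edge can be joined. -/
theorem IsPolytope.exists_skeleton_map [FiniteDimensional ℝ E] {P : Set E} (hP : IsPolytope P)
    {Y : Type*} [TopologicalSpace Y] (ψ : E → Y) (B : Set E → Set Y)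
    (hB : ∀ a ∈ vertices P, ∀ b ∈ vertices P, a ≠ b → IsEdge P (segment ℝ a b) →
      JoinedIn (B (segment ℝ a b)) (ψ a) (ψ b)) :
    ∃ f : E → Y, ContinuousOn f (skeleton P 1) ∧ (∀ a ∈ vertices P, f a = ψ a) ∧
      ∀ e, IsEdge P e → Set.MapsTo f e (B e) := by
  classical
  have hedge : ∀ e, ∃ g : E → Y, IsEdge P e →
      Continuous g ∧ (∀ v ∈ vertices P, v ∈ e → g v = ψ v) ∧ ∀ x, g x ∈ B e := by
    intro e
    by_cases he : IsEdge P e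
    swap
    · exact ⟨ψ, fun h => absurd h he⟩
    obtain ⟨a, ha, b, hb, hab, rfl⟩ := hP.exists_edge_eq_segment he
    obtain ⟨g, hg, hga, hgb, hgB⟩ := exists_continuous_of_joinedIn (hB a ha b hb hab he) hab
    refine ⟨g, fun _ => ⟨hg, fun v hv hm => ?_, hgB⟩⟩
    rcases eq_left_or_eq_right_of_mem_vertices he.1.subset hv hm with rfl | rfl
    · exact hga
    · exact hgb
  choose g hg using hedge
  -- A point that is not a vertex lies in at most one edge (`hsub`), so the choice of edge is
  -- harmless. Off the edges and vertices the value is irrelevant.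
  let f : E → Y := fun x => if x ∈ vertices P then ψ x else
    if h : ∃ e, IsEdge P e ∧ x ∈ e then g h.choose x else ψ x
  have hsub : ∀ e e' x, IsEdge P e → IsEdge P e' → x ∈ e → x ∈ e' → x ∉ vertices P → e ⊆ e' := by
    intro e e' x he he' hx hx' hv
    obtain ⟨a, ha, b, hb, hab, rfl⟩ := hP.exists_edge_eq_segment he
    rw [← insert_endpoints_openSegment] at hx
    rcases hx with rfl | rfl | hx
    · exact absurd ha hv
    · exact absurd hb hv
    · exact edge_subset_of_mem hP he.1 he'.1 hx hx'
  have hfe : ∀ e, IsEdge P e → ∀ x ∈ e, f x = g e x := by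
    intro e he x hx
    by_cases hv : x ∈ vertices P
    · simp only [f, if_pos hv]
      exact ((hg e he).2.1 x hv hx).symm
    · have h : ∃ e, IsEdge P e ∧ x ∈ e := ⟨e, he, hx⟩
      simp only [f, if_neg hv, dif_pos h]
      obtain ⟨h1, h2⟩ := h.choose_spec
      rw [(hsub _ _ x h1 he h2 hx hv).antisymm (hsub _ _ x he h1 hx h2 hv)]
  refine ⟨f, ?_, fun a ha => if_pos ha, fun e he x hx => ?_⟩
  · have hunion : skeleton P 1 = ⋃ F : {F | IsFace P F ∧ dim F ≤ 1}, F.1 := by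
      ext x
      simp [skeleton, and_assoc]
    have hfin : Finite {F | IsFace P F ∧ dim F ≤ 1} :=
      (hP.finite_faces.subset fun F h => h.1).to_subtype
    rw [hunion]
    refine (locallyFinite_of_finite _).continuousOn_iUnion
      (fun F => IsExposed.isClosed F.2.1 hP.isClosed) ?_
    rintro ⟨F, hF, hdim⟩
    rcases F.eq_empty_or_nonempty with rfl | hne
    · exact continuousOn_empty f
    rcases Nat.le_one_iff_eq_zero_or_eq_one.1 hdim with h0 | h1
    · obtain ⟨a, rfl⟩ := exists_eq_singleton_of_dim_eq_zero hne h0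
      exact continuousOn_singleton f a
    · exact (hg F ⟨hF, hne, h1⟩).1.continuousOn.congr (hfe F ⟨hF, hne, h1⟩)
  · rw [hfe e he x hx]
    exact (hg e he).2.2 x

end Polytope

/-! ### Graphs as one-dimensional complexes -/

section Body

variable {V : Type*} {G : SimpleGraph V}

lemma nodePoint_self (v : V) : nodePoint v v = 1 := by
  classical
  simp [nodePoint]

lemma nodePoint_of_ne {v w : V} (h : w ≠ v) : nodePoint v w = 0 := by
  classical
  simp [nodePoint, h]

lemma eq_or_eq_of_mem_segment_nodePoint {u v w : V} {p : V → ℝ}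
    (hp : p ∈ segment ℝ (nodePoint u) (nodePoint v)) (hw : p w ≠ 0) : w = u ∨ w = v := by
  by_contra! h
  obtain ⟨s, t, -, -, -, rfl⟩ := hp
  simp [nodePoint_of_ne h.1, nodePoint_of_ne h.2] at hw

lemma mem_verts_of_mem_body {K : G.Subgraph} {p : V → ℝ} (hp : p ∈ body K) {v : V}
    (hv : p v ≠ 0) : v ∈ K.verts := by
  rcases hp with ⟨w, hw, rfl⟩ | ⟨u, w, hadj, hp⟩
  · by_cases h : v = w
    · exact h ▸ hw
    · exact absurd (nodePoint_of_ne h) hv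
  · rcases eq_or_eq_of_mem_segment_nodePoint hp hv with rfl | rfl
    · exact K.edge_vert hadj
    · exact K.edge_vert hadj.symm

lemma adj_of_mem_body {K : G.Subgraph} {p : V → ℝ} (hp : p ∈ body K) {u v : V} (huv : u ≠ v)
    (hu : p u ≠ 0) (hv : p v ≠ 0) : K.Adj u v := by
  rcases hp with ⟨w, -, rfl⟩ | ⟨a, b, hadj, hp⟩
  · have h1 : u = w := by_contra fun h => hu (nodePoint_of_ne h)
    have h2 : v = w := by_contra fun h => hv (nodePoint_of_ne h)
    exact absurd (h1.trans h2.symm) huv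
  · rcases eq_or_eq_of_mem_segment_nodePoint hp hu with rfl | rfl <;>
      rcases eq_or_eq_of_mem_segment_nodePoint hp hv with rfl | rfl
    · exact absurd rfl huv
    · exact hadj
    · exact hadj.symm
    · exact absurd rfl huv

lemma nodePoint_mem_body {K : G.Subgraph} {v : V} (hv : v ∈ K.verts) : nodePoint v ∈ body K :=
  Or.inl ⟨v, hv, rfl⟩

lemma body_mono {K K' : G.Subgraph} (h : K ≤ K') : body K ⊆ body K' := by
  rintro p (⟨v, hv, rfl⟩ | ⟨u, v, hadj, hp⟩)
  · exact nodePoint_mem_body (h.1 hv)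
  · exact Or.inr ⟨u, v, h.2 hadj, hp⟩

/-- Every subset of the body of a graph is contained in the body of a smallest subgraph. -/
lemma exists_isSmallestSubgraph {A : Set (V → ℝ)} (hA : A ⊆ body (⊤ : G.Subgraph)) :
    ∃ H, IsSmallestSubgraph G A H := by
  -- The nonzero coordinates of a point of the body determine the node or arc that carries it, so
  -- every competing subgraph contains that cell, and so does their intersection.
  refine ⟨sInf {K | A ⊆ body K}, fun p hp => ?_, fun K hK => sInf_le hK⟩
  have hnode : ∀ v, p = nodePoint v →
      p ∈ body (sInf {K : G.Subgraph | A ⊆ body K}) := by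
    rintro v rfl
    refine nodePoint_mem_body ?_
    rw [SimpleGraph.Subgraph.verts_sInf]
    refine Set.mem_iInter₂.2 fun K hK => mem_verts_of_mem_body (hK hp) ?_
    simp [nodePoint_self]
  rcases hA hp with ⟨v, -, h⟩ | ⟨u, v, hadj, h⟩
  · exact hnode v h
  have huv : u ≠ v := G.ne_of_adj hadj.adj_sub
  have hseg := h
  rw [← insert_endpoints_openSegment] at h
  rcases h with h | h | ⟨s, t, hs, ht, -, hpst⟩
  · exact hnode u h
  · exact hnode v h
  · refine Or.inr ⟨u, v, ?_, hseg⟩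
    rw [SimpleGraph.Subgraph.sInf_adj]
    refine ⟨fun K hK => adj_of_mem_body (hK hp) huv ?_ ?_, hadj.adj_sub⟩
    · rw [← hpst]
      simp [nodePoint_self, nodePoint_of_ne huv, hs.ne']
    · rw [← hpst]
      simp [nodePoint_self, nodePoint_of_ne huv.symm, ht.ne']

lemma joinedIn_body_induce {T : Set V} (hT : (G.induce T).Preconnected) {u v : V} (hu : u ∈ T)
    (hv : v ∈ T) : JoinedIn (body ((⊤ : G.Subgraph).induce T)) (nodePoint u) (nodePoint v) := by
  obtain ⟨w⟩ := hT ⟨u, hu⟩ ⟨v, hv⟩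
  suffices h : ∀ a b : T, (G.induce T).Walk a b →
      JoinedIn (body ((⊤ : G.Subgraph).induce T)) (nodePoint a.1) (nodePoint b.1) from h _ _ w
  intro a b w
  induction w with
  | nil => exact JoinedIn.refl (nodePoint_mem_body (Subtype.property _))
  | @cons a b c h _ ih =>
    refine JoinedIn.trans (JoinedIn.of_segment_subset fun p hp => Or.inr ⟨a, b, ?_, hp⟩) ih
    exact ⟨a.2, b.2, h⟩

end Body

end GraphRep

/-! ### Supports of broken vectors -/

namespace GraphRep

section Sign

variable {V : Type*} {G : SimpleGraph V}

/-- In a preconnected induced subgraph there is an edge that leaves a given nonempty proper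
subset. -/
lemma exists_adj_of_preconnected_induce {T S : Set V} (hT : (G.induce T).Preconnected)
    (hST : S ⊆ T) {u w : V} (hu : u ∈ S) (hw : w ∈ T) (hwS : w ∉ S) :
    ∃ a ∈ S, ∃ b ∈ T, b ∉ S ∧ G.Adj a b := by
  obtain ⟨p⟩ := hT ⟨u, hST hu⟩ ⟨w, hw⟩
  obtain ⟨d, -, h1, h2⟩ := p.exists_boundary_dart (Subtype.val ⁻¹' S) hu hwS
  exact ⟨d.fst, h1, d.snd, d.snd.2, h2, d.adj⟩

lemma posSupp_subset_supp (x : V → ℝ) : posSupp x ⊆ supp x := fun _ h => ne_of_gt h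

lemma negSupp_subset_supp (x : V → ℝ) : negSupp x ⊆ supp x := fun _ h => ne_of_lt h

lemma disjoint_posSupp_negSupp (x : V → ℝ) : Disjoint (posSupp x) (negSupp x) :=
  Set.disjoint_left.2 fun v (h : 0 < x v) (h' : x v < 0) => lt_asymm h h'

lemma posSupp_neg (x : V → ℝ) : posSupp (-x) = negSupp x := by
  ext v; simp [posSupp, negSupp]

lemma negSupp_neg (x : V → ℝ) : negSupp (-x) = posSupp x := by
  ext v; simp [posSupp, negSupp]

lemma mem_posSupp_or_mem_negSupp {x : V → ℝ} {v : V} (h : v ∈ supp x) :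
    v ∈ posSupp x ∨ v ∈ negSupp x := (lt_or_gt_of_ne h).symm

variable {L : Submodule ℝ (V → ℝ)}

/-- If no edge joins the two parts of the support of `x`, a set `A` that is one of them is
a union of components of the support. -/
lemma mem_of_reachable_supp {x : V → ℝ} {A : Set V}
    (hA : ∀ a ∈ A, ∀ b ∈ supp x, G.Adj a b → b ∈ A) {u w : supp x} (hu : u.1 ∈ A)
    (h : (G.induce (supp x)).Reachable u w) : w.1 ∈ A := by
  obtain ⟨p⟩ := h
  induction p with
  | nil => exact hu
  | cons hadj _ ih => exact ih (hA _ hu _ (Subtype.property _) hadj)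

lemma reachable_induce_of_reachable_supp {x : V → ℝ} {A T : Set V}
    (hA : ∀ a ∈ A, ∀ b ∈ supp x, G.Adj a b → b ∈ A) (hAT : A ⊆ T) {u w : supp x} (hu : u.1 ∈ A)
    (hw : w.1 ∈ A) (h : (G.induce (supp x)).Reachable u w) :
    (G.induce T).Reachable ⟨u.1, hAT hu⟩ ⟨w.1, hAT hw⟩ := by
  obtain ⟨p⟩ := h
  induction p with
  | nil => exact SimpleGraph.Reachable.refl _
  | @cons a b c hadj _ ih =>
    have hb : b.1 ∈ A := hA _ hu _ b.2 hadj
    have hab : (G.induce T).Adj ⟨a.1, hAT hu⟩ ⟨b.1, hAT hb⟩ := hadj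
    exact hab.reachable.trans (ih hb hw)

lemma IsSemivalid.posSupp_closed (hL : IsSemivalid G L) {x : V → ℝ} (hx : x ∈ L)
    (hb : IsBroken G x) : ∀ a ∈ posSupp x, ∀ b ∈ supp x, G.Adj a b → b ∈ posSupp x := by
  intro a ha b hbx hadj
  rcases mem_posSupp_or_mem_negSupp hbx with h | h
  · exact h
  · exact absurd hadj ((hL.broken x hx hb.1 hb.2).1 a ha b h)

lemma IsSemivalid.negSupp_closed (hL : IsSemivalid G L) {x : V → ℝ} (hx : x ∈ L)
    (hb : IsBroken G x) : ∀ a ∈ negSupp x, ∀ b ∈ supp x, G.Adj a b → b ∈ negSupp x := by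
  intro a ha b hbx hadj
  rcases mem_posSupp_or_mem_negSupp hbx with h | h
  · exact absurd hadj.symm ((hL.broken x hx hb.1 hb.2).1 b h a ha)
  · exact h

/-- Each vertex of the neighborhood of the support of a broken vector has a neighbor in each
component of the support. -/
lemma IsSemivalid.exists_adj_of_mem_nbhd (hL : IsSemivalid G L) {x : V → ℝ} (hx : x ∈ L)
    (hb : IsBroken G x) {w : V} (hw : w ∈ nbhd G (supp x)) (u : supp x) :
    ∃ u' : supp x, (G.induce (supp x)).Reachable u u' ∧ G.Adj u'.1 w := by
  have h := (hL.broken x hx hb.1 hb.2).2 ((G.induce (supp x)).connectedComponentMk u)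
  rw [← h] at hw
  obtain ⟨-, v, ⟨u', hu', rfl⟩, hadj⟩ := hw
  refine ⟨u', ?_, hadj⟩
  rw [SimpleGraph.ConnectedComponent.mem_supp_iff] at hu'
  exact (SimpleGraph.ConnectedComponent.eq.1 hu').symm

lemma IsSemivalid.connected_negSupp (hL : IsSemivalid G L) {x : V → ℝ} (hx : x ∈ L)
    (hb : IsBroken G x) : (G.induce (negSupp x)).Preconnected := by
  rcases hL.components x hx hb.1 with h | h
  · exact absurd h.preconnected hb.2
  · exact h.2.preconnected

/-- The positive support of a broken vector becomes connected when the neighborhood of the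
support is added. -/
lemma IsSemivalid.preconnected_union_nbhd (hG : G.Connected) (hL : IsSemivalid G L)
    {x : V → ℝ} (hx : x ∈ L) (hb : IsBroken G x) :
    (G.induce (posSupp x ∪ nbhd G (supp x))).Preconnected := by
  have hclosed := hL.posSupp_closed hx hb
  obtain ⟨⟨u₀, hu₀⟩, ⟨v₀, hv₀⟩⟩ := hL.supp_nonempty x hx hb.1
  have huniv : (G.induce Set.univ).Preconnected := by
    intro a b
    exact ((SimpleGraph.induceUnivIso G).reachable_iff).1 (hG.preconnected _ _)
  -- The neighborhood must be nonempty to link the components: an edge of `G` leaving the positive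
  -- support provides a node of it.
  obtain ⟨a, ha, w, -, hwa, hadj⟩ := exists_adj_of_preconnected_induce huniv
    (Set.subset_univ _) hu₀ (Set.mem_univ v₀)
    (Set.disjoint_right.1 (disjoint_posSupp_negSupp x) hv₀)
  have hw : w ∈ nbhd G (supp x) :=
    ⟨fun h => hwa (hclosed a ha w h hadj), a, posSupp_subset_supp x ha, hadj⟩
  have hpos : ∀ (u : V) (hu : u ∈ posSupp x) (w : V) (hw : w ∈ nbhd G (supp x)),
      (G.induce (posSupp x ∪ nbhd G (supp x))).Reachable ⟨u, Or.inl hu⟩ ⟨w, Or.inr hw⟩ := by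
    intro u hu w hw
    obtain ⟨u', hreach, hadj'⟩ :=
      hL.exists_adj_of_mem_nbhd hx hb hw ⟨u, posSupp_subset_supp x hu⟩
    have hu' : u'.1 ∈ posSupp x := mem_of_reachable_supp hclosed hu hreach
    have h2 : (G.induce (posSupp x ∪ nbhd G (supp x))).Adj ⟨u'.1, Or.inl hu'⟩ ⟨w, Or.inr hw⟩ :=
      hadj'
    exact (reachable_induce_of_reachable_supp hclosed Set.subset_union_left hu hu' hreach).trans
      h2.reachable
  have key : ∀ c : ↥(posSupp x ∪ nbhd G (supp x)),
      (G.induce (posSupp x ∪ nbhd G (supp x))).Reachable ⟨w, Or.inr hw⟩ c := by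
    rintro ⟨c, hc | hc⟩
    · exact (hpos c hc w hw).symm
    · exact (hpos u₀ hu₀ w hw).symm.trans (hpos u₀ hu₀ c hc)
  exact fun b c => (key b).symm.trans (key c)

/-- The negative of a broken vector cannot be comparable to a broken vector. -/
lemma IsSemivalid.not_broken_of_opposite (hL : IsSemivalid G L) {x y : V → ℝ} (hx : x ∈ L)
    (hy : y ∈ L) (hbx : IsBroken G x) (hby : IsBroken G y) (h1 : posSupp x ⊆ negSupp y)
    (h2 : negSupp x ⊆ posSupp y) : False := by
  have hcon := hL.connected_negSupp hy hby
  obtain ⟨⟨u, hu⟩, ⟨v, hv⟩⟩ := hL.supp_nonempty x hx hbx.1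
  obtain ⟨w, hw, hwx⟩ : ∃ w ∈ negSupp y, w ∉ posSupp x := by
    by_contra! h
    exact hbx.2 (h1.antisymm h ▸ hcon)
  obtain ⟨a, ha, b, hb, hbx', hadj⟩ := exists_adj_of_preconnected_induce hcon h1 hu hw hwx
  have hbs : b ∉ supp x := by
    intro h
    rcases mem_posSupp_or_mem_negSupp h with h | h
    · exact hbx' h
    · exact Set.disjoint_left.1 (disjoint_posSupp_negSupp y) (h2 h) hb
  have hbn : b ∈ nbhd G (supp x) := ⟨hbs, a, posSupp_subset_supp x ha, hadj⟩
  -- The node `b` is also adjacent to a negative component of `x`, which lies in `posSupp y`. This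
  -- gives an edge between the two signs of `y`, impossible as `y` is broken.
  obtain ⟨v', hreach, hadj'⟩ :=
    hL.exists_adj_of_mem_nbhd hx hbx hbn ⟨v, negSupp_subset_supp x hv⟩
  have hv' : v'.1 ∈ negSupp x := mem_of_reachable_supp (hL.negSupp_closed hx hbx) hv hreach
  exact (hL.broken y hy hby.1 hby.2).1 v'.1 (h2 hv') b hb hadj'

end Sign

end GraphRep

/-! ### Comparable sign vectors -/

namespace GraphRep

section Comparable

variable {V : Type*}

/-- One of two sign vectors is obtained from the other by replacing entries by zero. -/
def Comparable (x y : V → ℝ) : Prop :=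
  (posSupp x ⊆ posSupp y ∧ negSupp x ⊆ negSupp y) ∨
    (posSupp y ⊆ posSupp x ∧ negSupp y ⊆ negSupp x)

lemma Comparable.symm {x y : V → ℝ} (h : Comparable x y) : Comparable y x := Or.symm h

lemma Comparable.disjoint {x y : V → ℝ} (h : Comparable x y) :
    Disjoint (posSupp x) (negSupp y) := by
  rcases h with h | h
  · exact (disjoint_posSupp_negSupp y).mono_left h.1
  · exact (disjoint_posSupp_negSupp x).mono_right h.2

lemma Comparable.neg {x y : V → ℝ} (h : Comparable x y) : Comparable (-x) (-y) := by
  unfold Comparable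
  simp only [posSupp_neg, negSupp_neg]
  exact h.imp And.symm And.symm

/-- Comparable vectors have no entries of opposite sign, so nothing cancels. -/
lemma Comparable.posSupp_smul_add_smul {x y : V → ℝ} (h : Comparable x y) {s t : ℝ} (hs : 0 < s)
    (ht : 0 < t) : posSupp (s • x + t • y) = posSupp x ∪ posSupp y := by
  ext v
  change 0 < s * x v + t * y v ↔ 0 < x v ∨ 0 < y v
  constructor
  · intro hv
    by_contra! hxy
    exact absurd hv (not_lt.2 (add_nonpos (mul_nonpos_of_nonneg_of_nonpos hs.le hxy.1)
      (mul_nonpos_of_nonneg_of_nonpos ht.le hxy.2)))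
  · rintro (hx | hy)
    · have hy : 0 ≤ y v := not_lt.1 fun hy => Set.disjoint_left.1 h.disjoint hx hy
      exact add_pos_of_pos_of_nonneg (mul_pos hs hx) (mul_nonneg ht.le hy)
    · have hx : 0 ≤ x v := not_lt.1 fun hx => Set.disjoint_left.1 h.symm.disjoint hy hx
      exact add_pos_of_nonneg_of_pos (mul_nonneg hs.le hx) (mul_pos ht hy)

lemma Comparable.smul_add_smul {x y : V → ℝ} (h : Comparable x y) {s t : ℝ} (hs : 0 < s)
    (ht : 0 < t) : posSupp (s • x + t • y) = posSupp x ∪ posSupp y ∧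
      negSupp (s • x + t • y) = negSupp x ∪ negSupp y := by
  refine ⟨h.posSupp_smul_add_smul hs ht, ?_⟩
  have := h.neg.posSupp_smul_add_smul hs ht
  rwa [smul_neg, smul_neg, ← neg_add, posSupp_neg, posSupp_neg, posSupp_neg] at this

lemma Comparable.add_eq {x y : V → ℝ} (h : Comparable x y) :
    posSupp (x + y) = posSupp x ∪ posSupp y ∧ negSupp (x + y) = negSupp x ∪ negSupp y := by
  simpa using h.smul_add_smul one_pos one_pos

lemma Comparable.add_eq_or {x y : V → ℝ} (h : Comparable x y) :
    (posSupp (x + y) = posSupp x ∧ negSupp (x + y) = negSupp x) ∨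
      (posSupp (x + y) = posSupp y ∧ negSupp (x + y) = negSupp y) := by
  obtain ⟨h1, h2⟩ := h.add_eq
  rw [h1, h2]
  rcases h with h | h
  · exact Or.inr ⟨Set.union_eq_right.2 h.1, Set.union_eq_right.2 h.2⟩
  · exact Or.inl ⟨Set.union_eq_left.2 h.1, Set.union_eq_left.2 h.2⟩

lemma Comparable.add_left {x y z : V → ℝ} (hxy : Comparable x y) (hx : Comparable x z)
    (hy : Comparable y z) : Comparable (x + y) z := by
  rcases hxy.add_eq_or with h | h <;> unfold Comparable <;> rw [h.1, h.2] <;> assumption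

lemma Comparable.add_add {x y z w : V → ℝ} (hxy : Comparable x y) (hzw : Comparable z w)
    (hxz : Comparable x z) (hxw : Comparable x w) (hyz : Comparable y z)
    (hyw : Comparable y w) : Comparable (x + y) (z + w) :=
  (hzw.add_left (hxy.add_left hxz hyz).symm (hxy.add_left hxw hyw).symm).symm

end Comparable

/-! ### Vertex nodes, carriers and opposite faces -/

section Representation

variable {V : Type*} {G : SimpleGraph V} {L : Submodule ℝ (V → ℝ)} {P : Set L}

/-- The cone of the sign fan of `L` that contains `x`. -/
def signClass (x : L) : Set L :=
  {y : L | posSupp (y : V → ℝ) = posSupp (x : V → ℝ) ∧ negSupp (y : V → ℝ) = negSupp (x : V → ℝ)}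

lemma mem_signClass_self (x : L) : x ∈ signClass x := ⟨rfl, rfl⟩

lemma signClass_mem_signFan (x : L) : signClass x ∈ signFan L := ⟨x, rfl⟩

lemma supp_subset_of_mem_closure_signClass {x y : L} (h : x ∈ closure (signClass y)) :
    posSupp (x : V → ℝ) ⊆ posSupp (y : V → ℝ) ∧ negSupp (x : V → ℝ) ⊆ negSupp (y : V → ℝ) := by
  have hcont : ∀ v : V, Continuous fun z : L => (z : V → ℝ) v := fun v =>
    (continuous_apply v).comp continuous_subtype_val
  constructor
  · intro v hv
    obtain ⟨z, hz, hzy⟩ := mem_closure_iff.1 h _ (isOpen_lt continuous_const (hcont v)) hv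
    rw [← hzy.1]
    exact hz
  · intro v hv
    obtain ⟨z, hz, hzy⟩ := mem_closure_iff.1 h _ (isOpen_lt (hcont v) continuous_const) hv
    rw [← hzy.2]
    exact hz

variable [Fintype V]

lemma isBoundaryFace_singleton {D : Set L} (hD : IsBoundaryFace P D) {a : L}
    (ha : a ∈ vertices P) (haD : a ∈ D) : IsBoundaryFace P {a} := by
  refine ⟨ha, Set.singleton_nonempty a, ?_⟩
  rintro rfl
  exact hD.2.2 (hD.1.subset.antisymm (Set.singleton_subset_iff.2 haD))

namespace IsPolytopalRepresentation

lemma neg_mem (hP : IsPolytopalRepresentation G L P) {x : L} (hx : x ∈ P) : -x ∈ P :=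
  hP.polytope.neg_mem hP.symmetric hx

lemma isBoundaryFace_neg (hP : IsPolytopalRepresentation G L P) {D : Set L}
    (hD : IsBoundaryFace P D) : IsBoundaryFace P (-D) := by
  refine ⟨hD.1.neg fun x hx => hP.neg_mem hx, hD.2.1.neg, fun h => hD.2.2 ?_⟩
  have hPneg : -P = P := Set.Subset.antisymm
    (fun x hx => by simpa using hP.neg_mem hx) (fun x hx => hP.neg_mem hx)
  rw [← neg_neg D, h, hPneg]

/-- The origin is the midpoint of `y` and `-y` for each `y` in `P`, so a face containing it is all
of `P`. -/
lemma zero_notMem (hP : IsPolytopalRepresentation G L P) {D : Set L}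
    (hD : IsBoundaryFace P D) : (0 : L) ∉ D := by
  intro h
  refine hD.2.2 (hD.1.subset.antisymm fun y hy => ?_)
  exact (IsExposed.isExtreme hD.1).left_mem_of_mem_openSegment hy (hP.neg_mem hy) h
    ⟨1 / 2, 1 / 2, by norm_num, by norm_num, by norm_num, by module⟩

/-- Condition (iv) is applied to the vertices as faces of `D`; passing to the closure of a sign cone
can only turn signs into zeros. -/
lemma comparable (hP : IsPolytopalRepresentation G L P) {D : Set L} (hD : IsBoundaryFace P D)
    {a b : L} (ha : a ∈ vertices P) (hb : b ∈ vertices P) (haD : a ∈ D) (hbD : b ∈ D) :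
    Comparable (a : V → ℝ) (b : V → ℝ) := by
  have hface : ∀ x ∈ vertices P, x ∈ D → IsFace D {x} := fun x hx hxD =>
    IsExposed.mono hx hD.1.subset (Set.singleton_subset_iff.2 hxD)
  have hint : ∀ x : L, intrinsicInterior ℝ {x} ⊆ signClass x := fun x => by
    simp [mem_signClass_self]
  rcases hP.inclusions D {a} {b} hD (isBoundaryFace_singleton hD ha haD)
    (isBoundaryFace_singleton hD hb hbD) (hface a ha haD) (hface b hb hbD) _
    (signClass_mem_signFan a) _ (signClass_mem_signFan b) (hint a) (hint b) with h | h
  · exact Or.inl (supp_subset_of_mem_closure_signClass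
      (IsExposed.subset h (subset_closure (mem_signClass_self a))))
  · exact Or.inr (supp_subset_of_mem_closure_signClass
      (IsExposed.subset h (subset_closure (mem_signClass_self b))))

lemma ne_zero (hP : IsPolytopalRepresentation G L P) {D : Set L} (hD : IsBoundaryFace P D)
    {a : L} (haD : a ∈ D) : (a : V → ℝ) ≠ 0 := by
  intro h
  rw [ZeroMemClass.coe_eq_zero] at h
  exact hP.zero_notMem hD (h ▸ haD)

end IsPolytopalRepresentation

/-- The segment from `c` to `d` is a broken edge of the boundary face `D` of `P`. -/
structure BrokenPair (G : SimpleGraph V) (L : Submodule ℝ (V → ℝ)) (P D : Set L) (c d : L) :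
    Prop where
  isBoundaryFace : IsBoundaryFace P D
  left : c ∈ vertices P
  right : d ∈ vertices P
  left_mem : c ∈ D
  right_mem : d ∈ D
  isEdge : IsEdge P (segment ℝ c d)
  broken : IsBroken G ((c : V → ℝ) + (d : V → ℝ))

lemma IsPolytopalRepresentation.isBrokenEdgeIn (hP : IsPolytopalRepresentation G L P) {D : Set L}
    {c d : L} (h : BrokenPair G L P D c d) :
    IsBrokenEdgeIn G L P (segment ℝ c d) (signClass (c + d)) := by
  have hcomp := hP.comparable h.isBoundaryFace h.left h.right h.left_mem h.right_mem
  refine ⟨h.isEdge, ⟨signClass_mem_signFan _, ?_⟩, fun x hx => ?_⟩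
  · rintro x ⟨hx, -⟩
    rw [Submodule.coe_add] at hx
    refine ⟨fun h0 => h.broken.2 ?_, hx ▸ h.broken.2⟩
    rw [← hx, h0]
    rintro ⟨v, hv⟩
    exact absurd (show (0 : ℝ) < 0 from hv) (lt_irrefl 0)
  · obtain ⟨s, t, hs, ht, -, rfl⟩ := intrinsicInterior_segment_subset c d hx
    obtain ⟨h1, h2⟩ := hcomp.smul_add_smul hs ht
    obtain ⟨h3, h4⟩ := hcomp.add_eq
    exact ⟨h1.trans h3.symm, h2.trans h4.symm⟩

lemma BrokenPair.inStar (hP : IsPolytopalRepresentation G L P) {D : Set L} {c d a : L}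
    (h : BrokenPair G L P D c d) (ha : a ∈ D) : InStar P a (segment ℝ c d) :=
  ⟨D, h.isBoundaryFace, ha, IsExposed.mono h.isEdge.1 h.isBoundaryFace.1.subset
    ((IsExposed.convex h.isBoundaryFace.1 hP.polytope.convex).segment_subset h.left_mem
      h.right_mem)⟩

/-- Broken edges in the closed star of a vertex have the same negative support. -/
lemma BrokenPair.negSupp_eq (hP : IsPolytopalRepresentation G L P) {D D' : Set L}
    {a c d c' d' : L} (ha : a ∈ vertices P) (h : BrokenPair G L P D c d)
    (h' : BrokenPair G L P D' c' d') (haD : a ∈ D) (haD' : a ∈ D') :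
    negSupp ((c : V → ℝ) + (d : V → ℝ)) = negSupp ((c' : V → ℝ) + (d' : V → ℝ)) := by
  have := hP.broken_edges a ha _ _ _ _ (h.inStar hP haD) (h'.inStar hP haD')
    (hP.isBrokenEdgeIn h) (hP.isBrokenEdgeIn h')
  have hmem : c + d ∈ signClass (c' + d') := this ▸ mem_signClass_self (c + d)
  exact hmem.2

/-- A choice of a node for each vertex: a node of the positive support that belongs to the
negative support of the broken edges near the antipode. -/
lemma exists_node_choice (hL : IsSemivalid G L) (hP : IsPolytopalRepresentation G L P)
    [Nonempty V] :
    ∃ φ : L → V, ∀ a ∈ vertices P, {a} ≠ P → φ a ∈ posSupp (a : V → ℝ) ∧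
      ∀ D c d, BrokenPair G L P D c d → -a ∈ D →
        φ a ∈ negSupp ((c : V → ℝ) + (d : V → ℝ)) := by
  have : ∀ a : L, ∃ v : V, a ∈ vertices P → {a} ≠ P → v ∈ posSupp (a : V → ℝ) ∧
      ∀ D c d, BrokenPair G L P D c d → -a ∈ D →
        v ∈ negSupp ((c : V → ℝ) + (d : V → ℝ)) := by
    intro a
    by_cases ha : a ∈ vertices P ∧ {a} ≠ P
    swap
    · exact ⟨Classical.arbitrary V, fun h h' => absurd ⟨h, h'⟩ ha⟩
    obtain ⟨ha, haP⟩ := ha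
    have hbd : IsBoundaryFace P {a} := ⟨ha, Set.singleton_nonempty a, haP⟩
    have hpos := (hL.supp_nonempty a a.2 (hP.ne_zero hbd rfl)).1
    by_cases hex : ∃ D c d, BrokenPair G L P D c d ∧ -a ∈ D
    · obtain ⟨D, c, d, hb, haD⟩ := hex
      have hna := hP.symmetric a ha
      have hcomp := (hP.comparable hb.isBoundaryFace hb.left hb.right hb.left_mem
        hb.right_mem).add_left
        (hP.comparable hb.isBoundaryFace hb.left hna hb.left_mem haD)
        (hP.comparable hb.isBoundaryFace hb.right hna hb.right_mem haD)
      rw [Submodule.coe_neg] at hcomp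
      -- The vectors `-a` and `c + d` are comparable, so these two sets are nested; their
      -- intersection is the smaller one, and both are nonempty.
      obtain ⟨v, hv, hv'⟩ : (posSupp (a : V → ℝ) ∩
          negSupp ((c : V → ℝ) + (d : V → ℝ))).Nonempty := by
        rw [← negSupp_neg]
        rcases hcomp with h | h
        · rw [Set.inter_eq_right.2 h.2]
          exact (hL.supp_nonempty _ (L.add_mem c.2 d.2) hb.broken.1).2
        · rw [Set.inter_eq_left.2 h.2, negSupp_neg]
          exact hpos
      refine ⟨v, fun _ _ => ⟨hv, fun D' c' d' hb' haD' => ?_⟩⟩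
      rwa [← hb.negSupp_eq hP hna hb' haD haD']
    · obtain ⟨v, hv⟩ := hpos
      exact ⟨v, fun _ _ => ⟨hv, fun D c d hb haD => absurd ⟨D, c, d, hb, haD⟩ hex⟩⟩
  choose φ hφ using this
  exact ⟨φ, hφ⟩

/-- A set `T` of nodes that is suitable for carrying the image of the vertex or edge `e` of `P`
with endpoints `a` and `b`. -/
structure CellSet (G : SimpleGraph V) (L : Submodule ℝ (V → ℝ)) (P : Set L) (φ : L → V)
    (e : Set L) (a b : L) (T : Set V) : Prop where
  left : a ∈ vertices P
  right : b ∈ vertices P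
  eq_segment : e = segment ℝ a b
  isEdge : a ≠ b → IsEdge P e
  node_mem : ∀ v ∈ vertices P, v ∈ e → φ v ∈ T
  preconnected : (G.induce T).Preconnected
  subset_posSupp : a = b ∨ ¬ IsBroken G ((a : V → ℝ) + (b : V → ℝ)) →
    T ⊆ posSupp ((a : V → ℝ) + (b : V → ℝ))
  subset_union : T ⊆ posSupp ((a : V → ℝ) + (b : V → ℝ)) ∪
    nbhd G (supp ((a : V → ℝ) + (b : V → ℝ)))
  subset_negSupp : ∀ D c d, BrokenPair G L P D c d → -a ∈ D → -b ∈ D →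
    T ⊆ negSupp ((c : V → ℝ) + (d : V → ℝ))

lemma exists_cellSet (hG : G.Connected) (hL : IsSemivalid G L)
    (hP : IsPolytopalRepresentation G L P) {φ : L → V}
    (hφ : ∀ a ∈ vertices P, {a} ≠ P → φ a ∈ posSupp (a : V → ℝ) ∧
      ∀ D c d, BrokenPair G L P D c d → -a ∈ D →
        φ a ∈ negSupp ((c : V → ℝ) + (d : V → ℝ)))
    {e : Set L} (he : IsBoundaryFace P e) (hdim : dim e ≤ 1) :
    ∃ a b T, CellSet G L P φ e a b T := by
  rcases Nat.le_one_iff_eq_zero_or_eq_one.1 hdim with h0 | h1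
  · obtain ⟨a, rfl⟩ := exists_eq_singleton_of_dim_eq_zero he.2.1 h0
    obtain ⟨h1, h2⟩ := hφ a he.1 he.2.2
    -- A vertex is treated as the degenerate edge with `b = a`, since `a + a` has the signs of `a`.
    have hpos : φ a ∈ posSupp ((a : V → ℝ) + (a : V → ℝ)) := by
      rw [(hP.comparable he he.1 he.1 rfl rfl).add_eq.1]
      exact Or.inl h1
    refine ⟨a, a, {φ a}, he.1, he.1, by simp, fun h => absurd rfl h, ?_, ?_, ?_, ?_, ?_⟩
    · rintro _ - rfl
      rfl
    · exact SimpleGraph.Preconnected.of_subsingleton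
    · exact fun _ => Set.singleton_subset_iff.2 hpos
    · exact Set.singleton_subset_iff.2 (Or.inl hpos)
    · exact fun D c d hb haD _ => Set.singleton_subset_iff.2 (h2 D c d hb haD)
  have hedge : IsEdge P e := ⟨he.1, he.2.1, h1⟩
  obtain ⟨a, ha, b, hb, hab, rfl⟩ := hP.polytope.exists_edge_eq_segment hedge
  have hae := left_mem_segment ℝ a b
  have hbe := right_mem_segment ℝ a b
  have hcomp := hP.comparable he ha hb hae hbe
  have hadd := hcomp.add_eq
  have hne : ∀ v ∈ vertices P, v ∈ segment ℝ a b → {v} ≠ P := fun v hv hve =>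
    (isBoundaryFace_singleton he hv hve).2.2
  have hmem : ∀ v ∈ vertices P, v ∈ segment ℝ a b →
      φ v ∈ posSupp ((a : V → ℝ) + (b : V → ℝ)) := by
    intro v hv hve
    rw [hadd.1]
    rcases eq_left_or_eq_right_of_mem_vertices he.1.subset hv hve with rfl | rfl
    · exact Or.inl (hφ v hv (hne v hv hve)).1
    · exact Or.inr (hφ v hv (hne v hv hve)).1
  have hsumL := L.add_mem a.2 b.2
  have hsum0 : (a : V → ℝ) + (b : V → ℝ) ≠ 0 := by
    intro h
    have := hmem a ha hae
    rw [h] at this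
    exact lt_irrefl (0 : ℝ) this
  have hnega := hP.symmetric a ha
  have hnegb := hP.symmetric b hb
  have hcompneg : ∀ D c d, BrokenPair G L P D c d → -a ∈ D → -b ∈ D →
      Comparable (-((a : V → ℝ) + (b : V → ℝ))) ((c : V → ℝ) + (d : V → ℝ)) := by
    intro D c d h haD hbD
    have hD := h.isBoundaryFace
    rw [neg_add]
    exact Comparable.add_add (hP.comparable hD hnega hnegb haD hbD)
      (hP.comparable hD h.left h.right h.left_mem h.right_mem)
      (hP.comparable hD hnega h.left haD h.left_mem)
      (hP.comparable hD hnega h.right haD h.right_mem)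
      (hP.comparable hD hnegb h.left hbD h.left_mem)
      (hP.comparable hD hnegb h.right hbD h.right_mem)
  by_cases hbr : IsBroken G ((a : V → ℝ) + (b : V → ℝ))
  · refine ⟨a, b, posSupp ((a : V → ℝ) + b) ∪ nbhd G (supp ((a : V → ℝ) + b)), ha, hb, rfl,
      fun _ => hedge, fun v hv hve => Or.inl (hmem v hv hve),
      hL.preconnected_union_nbhd hG hsumL hbr, ?_, subset_rfl, ?_⟩
    · rintro (h | h)
      · exact absurd h hab
      · exact absurd hbr h
    · intro D c d h haD hbD
      -- Nothing broken lies opposite to a broken edge: whichever of the two comparable vectors is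
      -- smaller, `not_broken_of_opposite` applies.
      exfalso
      have hcL := L.add_mem c.2 d.2
      have hc := hcompneg D c d h haD hbD
      unfold Comparable at hc
      rw [posSupp_neg, negSupp_neg] at hc
      rcases hc with h' | h'
      · exact hL.not_broken_of_opposite hsumL hcL hbr h.broken h'.2 h'.1
      · exact hL.not_broken_of_opposite hcL hsumL h.broken hbr h'.1 h'.2
  have hcon : (G.induce (posSupp ((a : V → ℝ) + (b : V → ℝ)))).Preconnected := by
    by_contra h
    exact hbr ⟨hsum0, h⟩
  by_cases hex : ∃ D c d, BrokenPair G L P D c d ∧ -a ∈ D ∧ -b ∈ D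
  · obtain ⟨D, c, d, h, haD, hbD⟩ := hex
    -- By comparability the intersection is one of the two sets, and each of them is connected.
    refine ⟨a, b, posSupp ((a : V → ℝ) + b) ∩ negSupp ((c : V → ℝ) + d), ha, hb, rfl,
      fun _ => hedge, fun v hv hve => ⟨hmem v hv hve, ?_⟩, ?_, fun _ => Set.inter_subset_left,
      Set.inter_subset_left.trans Set.subset_union_left, ?_⟩
    · refine (hφ v hv (hne v hv hve)).2 D c d h ?_
      rcases eq_left_or_eq_right_of_mem_vertices he.1.subset hv hve with rfl | rfl <;> assumption
    · have hc := hcompneg D c d h haD hbD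
      unfold Comparable at hc
      rw [posSupp_neg, negSupp_neg] at hc
      rcases hc with h' | h'
      · rwa [Set.inter_eq_left.2 h'.2]
      · rw [Set.inter_eq_right.2 h'.2]
        exact hL.connected_negSupp (L.add_mem c.2 d.2) h.broken
    · intro D' c' d' h' haD' hbD'
      rw [h.negSupp_eq hP hnega h' haD haD']
      exact Set.inter_subset_right
  · exact ⟨a, b, posSupp ((a : V → ℝ) + b), ha, hb, rfl, fun _ => hedge, hmem, hcon,
      fun _ => subset_rfl, Set.subset_union_left,
      fun D c d h haD hbD => absurd ⟨D, c, d, h, haD, hbD⟩ hex⟩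

lemma CellSet.brokenPair {φ : L → V} {D e : Set L}
    {a b : L} {T : Set V} (h : CellSet G L P φ e a b T) (hD : IsBoundaryFace P D) (heD : e ⊆ D)
    (hbr : ¬ (a = b ∨ ¬ IsBroken G ((a : V → ℝ) + (b : V → ℝ)))) : BrokenPair G L P D a b := by
  push Not at hbr
  obtain ⟨ha, hb, rfl, hedge, -⟩ := h
  exact ⟨hD, ha, hb, heD (left_mem_segment ℝ a b), heD (right_mem_segment ℝ a b), hedge hbr.1,
    hbr.2⟩

/-- The larger carrier of a broken edge still misses the negative support of `a + b`, to which every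
opposite carrier is confined. -/
lemma CellSet.disjoint_of_brokenPair {φ : L → V} {D e e' : Set L} {a b a' b' : L} {T T' : Set V}
    (h : CellSet G L P φ e a b T) (h' : CellSet G L P φ e' a' b' T')
    (hb : BrokenPair G L P D a b) (ha' : -a' ∈ D) (hb' : -b' ∈ D) : Disjoint T T' := by
  refine Disjoint.mono h.subset_union (h'.subset_negSupp D a b hb ha' hb') ?_
  refine Disjoint.union_left (disjoint_posSupp_negSupp _) (Set.disjoint_left.2 fun v hv hv' => ?_)
  exact hv.1 (negSupp_subset_supp _ hv')

lemma CellSet.disjoint (hP : IsPolytopalRepresentation G L P) {φ : L → V} {D e e' : Set L}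
    {a b a' b' : L} {T T' : Set V} (hD : IsBoundaryFace P D) (h : CellSet G L P φ e a b T)
    (h' : CellSet G L P φ e' a' b' T') (heD : e ⊆ D) (heD' : e' ⊆ -D) : Disjoint T T' := by
  have haD : a ∈ D := heD (h.eq_segment ▸ left_mem_segment ℝ a b)
  have hbD : b ∈ D := heD (h.eq_segment ▸ right_mem_segment ℝ a b)
  have haD' : -a' ∈ D := heD' (h'.eq_segment ▸ left_mem_segment ℝ a' b')
  have hbD' : -b' ∈ D := heD' (h'.eq_segment ▸ right_mem_segment ℝ a' b')
  by_cases hbr : a = b ∨ ¬ IsBroken G ((a : V → ℝ) + (b : V → ℝ))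
  swap
  · exact h.disjoint_of_brokenPair h' (h.brokenPair hD heD hbr) haD' hbD'
  by_cases hbr' : a' = b' ∨ ¬ IsBroken G ((a' : V → ℝ) + (b' : V → ℝ))
  swap
  · refine (h'.disjoint_of_brokenPair h (h'.brokenPair (hP.isBoundaryFace_neg hD) heD' hbr')
      ?_ ?_).symm <;> simpa
  refine Disjoint.mono (h.subset_posSupp hbr) (h'.subset_posSupp hbr') ?_
  have ha' := hP.symmetric a' h'.left
  have hb' := hP.symmetric b' h'.right
  rw [← negSupp_neg ((a' : V → ℝ) + _), neg_add]
  exact (Comparable.add_add (hP.comparable hD h.left h.right haD hbD)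
    (hP.comparable hD ha' hb' haD' hbD') (hP.comparable hD h.left ha' haD haD')
    (hP.comparable hD h.left hb' haD hbD') (hP.comparable hD h.right ha' hbD haD')
    (hP.comparable hD h.right hb' hbD hbD')).disjoint

/-- Faces of antipodal faces of a centrally symmetric polytope lie in opposite boundary faces. -/
lemma IsPolytopalRepresentation.exists_opposite (hP : IsPolytopalRepresentation G L P)
    {F F' : Set L} (hF : F ⊆ P) (hF' : F' ⊆ P) (hne : F.Nonempty) (hne' : F'.Nonempty)
    (h : Antipodal P F F') : ∃ D, IsBoundaryFace P D ∧ F ⊆ D ∧ F' ⊆ -D := by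
  obtain ⟨l, c, c', -, hcc, hl, hl', hbd⟩ := h
  obtain ⟨x, hx⟩ := hne
  obtain ⟨y, hy⟩ := hne'
  have h1 := (hbd (-x) (hP.neg_mem (hF hx))).2
  have h2 := (hbd (-y) (hP.neg_mem (hF' hy))).1
  rw [map_neg, hl x hx] at h1
  rw [map_neg, hl' y hy] at h2
  -- Symmetry of `P` forces the two supporting values to be opposite, so the face where `l` is
  -- minimal and its negative contain `F` and `F'`.
  have hc : c' = -c := by linarith
  refine ⟨{z ∈ P | ∀ w ∈ P, (-l) w ≤ (-l) z}, ⟨fun _ => ⟨-l, rfl⟩, ?_, ?_⟩, ?_, ?_⟩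
  · refine ⟨x, hF hx, fun w hw => ?_⟩
    simpa [hl x hx] using (hbd w hw).1
  · intro h
    have hy' : y ∈ {z ∈ P | ∀ w ∈ P, (-l) w ≤ (-l) z} := by
      rw [h]
      exact hF' hy
    have := hy'.2 x (hF hx)
    simp only [neg_apply, hl x hx, hl' y hy] at this
    linarith
  · refine fun z hz => ⟨hF hz, fun w hw => ?_⟩
    simpa [hl z hz] using (hbd w hw).1
  · refine fun z hz => ⟨hP.neg_mem (hF' hz), fun w hw => ?_⟩
    have := (hbd w hw).1
    simp only [neg_apply, map_neg, hl' z hz]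
    linarith

end Representation

end GraphRep

theorem mainTheorem6 {V : Type*} [Fintype V] (G : SimpleGraph V) (hG : G.Connected)
    (L : Submodule ℝ (V → ℝ)) (hL : GraphRep.IsSemivalid G L)
    (P : Set L) (hP : GraphRep.IsPolytopalRepresentation G L P) :
    ∃ f : L → V → ℝ, GraphRep.IsCellularMap G P f ∧
      ∀ F F' : Set L, GraphRep.IsFace P F → GraphRep.IsFace P F' → GraphRep.Antipodal P F F' →
        ∃ H H' : G.Subgraph,
          GraphRep.IsSmallestSubgraph G (f '' GraphRep.skeleton F 1) H ∧
          GraphRep.IsSmallestSubgraph G (f '' GraphRep.skeleton F' 1) H' ∧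
          Disjoint H.verts H'.verts := by
  open GraphRep in
  have := hG.nonempty
  obtain ⟨φ, hφ⟩ := exists_node_choice hL hP
  have hT : ∀ e : Set L, ∃ T : Set V, IsFace P e → e.Nonempty → dim e ≤ 1 →
      (e ≠ P → ∃ a b, CellSet G L P φ e a b T) ∧ (∀ v ∈ vertices P, v ∈ e → φ v ∈ T) ∧
        (G.induce T).Preconnected := by
    intro e
    by_cases he : IsBoundaryFace P e ∧ dim e ≤ 1
    · obtain ⟨a, b, T, h⟩ := exists_cellSet hG hL hP hφ he.1 he.2
      exact ⟨T, fun _ _ _ => ⟨fun _ => ⟨a, b, h⟩, h.node_mem, h.preconnected⟩⟩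
    -- The only cell left is `P` itself, when its dimension is at most one. It lies in no proper
    -- face, so no disjointness is asked of its carrier.
    · refine ⟨Set.univ, fun h1 h2 h3 => ⟨fun h4 => absurd ⟨⟨h1, h2, h4⟩, h3⟩ he,
        fun _ _ _ => trivial, fun a b => ?_⟩⟩
      exact ((SimpleGraph.induceUnivIso G).reachable_iff).1 (hG.preconnected _ _)
  choose T hT using hT
  obtain ⟨f, hf, hfv, hfe⟩ := hP.polytope.exists_skeleton_map (fun a => nodePoint (φ a))
    (fun e => body ((⊤ : G.Subgraph).induce (T e))) (by
      intro a ha b hb _ he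
      obtain ⟨-, h1, h2⟩ := hT _ he.1 he.2.1 he.2.2.le
      exact joinedIn_body_induce h2 (h1 a ha (left_mem_segment ℝ a b))
        (h1 b hb (right_mem_segment ℝ a b)))
  have hmap : ∀ e, IsFace P e → e.Nonempty → dim e ≤ 1 →
      Set.MapsTo f e (body ((⊤ : G.Subgraph).induce (T e))) := by
    intro e he hne hdim
    rcases Nat.le_one_iff_eq_zero_or_eq_one.1 hdim with h0 | h1
    · obtain ⟨a, rfl⟩ := exists_eq_singleton_of_dim_eq_zero hne h0
      rintro _ rfl
      rw [hfv _ he]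
      exact nodePoint_mem_body ((hT _ he hne hdim).2.1 _ he rfl)
    · exact hfe e ⟨he, hne, h1⟩
  have hbody : ∀ F, IsFace P F → f '' skeleton F 1 ⊆ body (⊤ : G.Subgraph) := by
    rintro F hF _ ⟨x, ⟨e, he, hdim, hx⟩, rfl⟩
    exact body_mono le_top (hmap e (hP.polytope.isFace_trans hF he) ⟨x, hx⟩ hdim hx)
  refine ⟨f, ⟨hf, Set.mapsTo_iff_image_subset.2 (hbody P (IsExposed.refl P)), ?_⟩, ?_⟩
  · rintro x ⟨F, hF, hdim, hx⟩
    obtain ⟨a, rfl⟩ := exists_eq_singleton_of_dim_eq_zero ⟨x, hx⟩ (Nat.le_zero.1 hdim)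
    obtain rfl : x = a := hx
    exact ⟨φ x, (hfv x hF).symm⟩
  intro F F' hF hF' hanti
  obtain ⟨H, hH⟩ := exists_isSmallestSubgraph (hbody F hF)
  obtain ⟨H', hH'⟩ := exists_isSmallestSubgraph (hbody F' hF')
  -- By minimality, `H` lies in the subgraph induced on the union of the carriers of the cells of
  -- `F`.
  have hverts : ∀ F H, IsFace P F → IsSmallestSubgraph G (f '' skeleton F 1) H →
      ∀ v ∈ H.verts, ∃ e, IsFace F e ∧ e.Nonempty ∧ dim e ≤ 1 ∧ v ∈ T e := by
    intro F H hF hH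
    suffices h : H ≤ (⊤ : G.Subgraph).induce
        {v | ∃ e, IsFace F e ∧ e.Nonempty ∧ dim e ≤ 1 ∧ v ∈ T e} from h.1
    refine hH.2 ?_
    rintro _ ⟨x, ⟨e, he, hdim, hx⟩, rfl⟩
    refine body_mono (SimpleGraph.Subgraph.induce_mono_right fun v hv => ?_)
      (hmap e (hP.polytope.isFace_trans hF he) ⟨x, hx⟩ hdim hx)
    exact ⟨e, he, ⟨x, hx⟩, hdim, hv⟩
  refine ⟨H, H', hH, hH', Set.disjoint_left.2 fun v hv hv' => ?_⟩
  obtain ⟨e, he, hne, hdim, hve⟩ := hverts F H hF hH v hv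
  obtain ⟨e', he', hne', hdim', hve'⟩ := hverts F' H' hF' hH' v hv'
  -- Antipodality constrains only nonempty faces; the cells carrying the common node show that `F`
  -- and `F'` are nonempty.
  obtain ⟨D, hD, hFD, hFD'⟩ := hP.exists_opposite hF.subset hF'.subset
    (hne.mono he.subset) (hne'.mono he'.subset) hanti
  have hne_P : ∀ D e, IsBoundaryFace P D → e ⊆ D → e ≠ P := fun D e hD he h =>
    hD.2.2 (hD.1.subset.antisymm (h ▸ he))
  have heD := he.subset.trans hFD
  have heD' := he'.subset.trans hFD'
  obtain ⟨a, b, hc⟩ := (hT e (hP.polytope.isFace_trans hF he) hne hdim).1 (hne_P D e hD heD)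
  obtain ⟨a', b', hc'⟩ := (hT e' (hP.polytope.isFace_trans hF' he') hne' hdim').1
    (hne_P (-D) e' (hP.isBoundaryFace_neg hD) heD')
  exact Set.disjoint_left.1 (hc.disjoint hP hD hc' heD heD') hve hve'
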